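/- Let $k$ be a commutative artinian ring, let $H$ and $R$ be $k$-algebras that are finitely generated as $k$-modules, and let ${}_RM_H$ be an $R$-$H$-bimodule on which $k$ acts centrally and which is finitely generated over $k$. Let $$A=\begin{pmatrix} H & 0\\ M & R\end{pmatrix}$$ be the triangular matrix algebra, and assume that $A$ is basic (i.e. $A_A$ is a finite direct sum of pairwise non-isomorphic indecomposable modules), that $H$ is hereditary, and that $R$ is local but not a skew field (so $A$ is a local extension of the hereditary algebra $H$). Modules are finitely generated right modules. Let $\mathcal L_A$ be the left part of the module category of $A$: the class of indecomposable $A$-modules $X$ such that every predecessor of $X$ has projective dimension at most one, where a predecessor of $X$ is an indecomposable module $Y$ for which there is a path $Y=X_0\to X_1\to\cdots\to X_t=X$ of nonzero morphisms between indecomposable modules. Let $P$ be the supporting projective of $\mathcal L_A$, i.e. the direct sum of all projective modules in $\mathcal L_A$, one from each isomorphism class, and let $A_\lambda=\operatorname{End}_A(P)$ be the left support of $A$. Then $A_\lambda$ equals $H$. Precisely, with $e=\begin{pmatrix}1&0\\0&0\end{pmatrix}$, there is an isomorphism $\varphi\colon P\to eA$ of right $A$-modules and an isomorphism $\psi\colon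 A_\lambda\to H$ of $k$-algebras such that $\varphi(f(p))=\begin{pmatrix}\psi(f)&0\\0&0\end{pmatrix}\varphi(p)$ for all $f\in A_\lambda$ and $p\in P$. -/

import Mathlib

open CategoryTheory

universe u v

/-! Right modules over `A` are modules over `Aᵐᵒᵖ`. -/

section TriangularMatrix

/-- The set of lower triangular matrices `[[h, 0], [m, r]]` with `h ∈ H`, `m ∈ M`, `r ∈ R`,
where `M` is an `R`-`H`-bimodule. -/
@[ext]
structure TriMatrix (H M R : Type u) where
  h : H
  m : M
  r : R

namespace TriMatrix

variable {H M R : Type u}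

/-- The obvious bijection with triples; it is used only to transport the additive structure. -/
def equivProd (H M R : Type u) : TriMatrix H M R ≃ H × M × R where
  toFun a := (a.h, a.m, a.r)
  invFun p := ⟨p.1, p.2.1, p.2.2⟩
  left_inv _ := rfl
  right_inv _ := rfl

section Additive

variable [Ring H] [AddCommGroup M] [Ring R]

instance : AddCommGroup (TriMatrix H M R) := (equivProd H M R).addCommGroup

@[simp] theorem zero_h : (0 : TriMatrix H M R).h = 0 := rfl
@[simp] theorem zero_m : (0 : TriMatrix H M R).m = 0 := rfl
@[simp] theorem zero_r : (0 : TriMatrix H M R).r = 0 := rfl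
@[simp] theorem add_h (a b : TriMatrix H M R) : (a + b).h = a.h + b.h := rfl
@[simp] theorem add_m (a b : TriMatrix H M R) : (a + b).m = a.m + b.m := rfl
@[simp] theorem add_r (a b : TriMatrix H M R) : (a + b).r = a.r + b.r := rfl

instance : One (TriMatrix H M R) := ⟨⟨1, 0, 1⟩⟩

@[simp] theorem one_h : (1 : TriMatrix H M R).h = 1 := rfl
@[simp] theorem one_m : (1 : TriMatrix H M R).m = 0 := rfl
@[simp] theorem one_r : (1 : TriMatrix H M R).r = 1 := rfl

end Additive

variable [Ring H] [AddCommGroup M] [Ring R] [Module R M] [Module Hᵐᵒᵖ M]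

/-- Matrix multiplication. -/
instance : Mul (TriMatrix H M R) :=
  ⟨fun a b => ⟨a.h * b.h, MulOpposite.op b.h • a.m + a.r • b.m, a.r * b.r⟩⟩

@[simp] theorem mul_h (a b : TriMatrix H M R) : (a * b).h = a.h * b.h := rfl
@[simp] theorem mul_m (a b : TriMatrix H M R) :
    (a * b).m = MulOpposite.op b.h • a.m + a.r • b.m := rfl
@[simp] theorem mul_r (a b : TriMatrix H M R) : (a * b).r = a.r * b.r := rfl

variable [SMulCommClass R Hᵐᵒᵖ M]

instance : Ring (TriMatrix H M R) where
  __ := (inferInstance : AddCommGroup (TriMatrix H M R))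
  left_distrib a b c := by
    ext <;> simp [mul_add, add_smul]
    abel
  right_distrib a b c := by
    ext <;> simp [add_mul, add_smul]
    abel
  zero_mul a := by ext <;> simp
  mul_zero a := by ext <;> simp
  mul_assoc a b c := by
    ext <;> simp [mul_assoc, mul_smul, smul_comm, add_assoc]
  one_mul a := by ext <;> simp
  mul_one a := by ext <;> simp

variable {k : Type v} [CommRing k] [Algebra k H] [Algebra k R] [Module k M]
  [IsScalarTower k R M] [IsScalarTower k Hᵐᵒᵖ M]

/-- The entrywise `k`-algebra structure: `c ∈ k` goes to the matrix `[[c, 0], [0, c]]`.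
It requires that `k` acts centrally on `M`. -/
instance : Algebra k (TriMatrix H M R) where
  smul c a := ⟨c • a.h, c • a.m, c • a.r⟩
  algebraMap :=
    { toFun c := ⟨algebraMap k H c, 0, algebraMap k R c⟩
      map_one' := by ext <;> simp
      map_mul' a b := by ext <;> simp
      map_zero' := by ext <;> simp
      map_add' a b := by ext <;> simp }
  commutes' c a := by
    ext
    · exact Algebra.commutes c a.h
    · change MulOpposite.op a.h • (0 : M) + algebraMap k R c • a.m
        = MulOpposite.op (algebraMap k H c) • a.m + a.r • (0 : M)
      rw [← MulOpposite.algebraMap_apply, algebraMap_smul, algebraMap_smul]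
      simp
    · exact Algebra.commutes c a.r
  smul_def' c a := by
    ext
    · exact Algebra.smul_def c a.h
    · change c • a.m = MulOpposite.op a.h • (0 : M) + algebraMap k R c • a.m
      rw [algebraMap_smul]
      simp
    · exact Algebra.smul_def c a.r

/-- The idempotent matrix `e = [[1, 0], [0, 0]]`. -/
def e (H M R : Type u) [Ring H] [AddCommGroup M] [Ring R] : TriMatrix H M R := ⟨1, 0, 0⟩

/-- The right ideal `e A` of the triangular matrix ring `A`, that is, its first row `(H, 0)`. -/
def firstRow (H M R : Type u) [Ring H] [AddCommGroup M] [Ring R] [Module R M] [Module Hᵐᵒᵖ M]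
    [SMulCommClass R Hᵐᵒᵖ M] : Submodule (TriMatrix H M R)ᵐᵒᵖ (TriMatrix H M R) :=
  Submodule.span (TriMatrix H M R)ᵐᵒᵖ {e H M R}

/-- `h ↦ [[h, 0], [0, 0]]`. -/
def inl {H : Type u} (M R : Type u) [AddCommGroup M] [Ring R] (h : H) : TriMatrix H M R := ⟨h, 0, 0⟩

end TriMatrix

end TriangularMatrix

section Rings

/-- A ring is (right) hereditary if all its right ideals are projective right modules. -/
def IsRightHereditary (H : Type u) [Ring H] : Prop :=
  ∀ I : Submodule Hᵐᵒᵖ H, Module.Projective Hᵐᵒᵖ I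

/-- A ring `A` is basic if the right module `A` is a finite direct sum of pairwise non-isomorphic
indecomposable modules. -/
def IsBasicRing (A : Type u) [Ring A] : Prop :=
  ∃ (n : ℕ) (P : Fin n → Submodule Aᵐᵒᵖ A), DirectSum.IsInternal P ∧
    (∀ i, Indecomposable (ModuleCat.of Aᵐᵒᵖ (P i))) ∧
    (∀ i j, i ≠ j → IsEmpty (P i ≃ₗ[Aᵐᵒᵖ] P j))

/-- A ring is a skew field if it is nontrivial and all its nonzero elements are invertible. -/
def IsSkewField (R : Type u) [Ring R] : Prop :=
  Nontrivial R ∧ ∀ r : R, r ≠ 0 → IsUnit r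

end Rings

section LeftSupport

variable (A : Type u) [Ring A]

/-- The class `ind A` of indecomposable finitely generated right `A`-modules. -/
def Ind (X : ModuleCat.{u} Aᵐᵒᵖ) : Prop :=
  Module.Finite Aᵐᵒᵖ X ∧ Indecomposable X

/-- A path of length one: a nonzero morphism between indecomposable modules. -/
def IndStep (X Y : ModuleCat.{u} Aᵐᵒᵖ) : Prop :=
  Ind A X ∧ Ind A Y ∧ ∃ f : X ⟶ Y, f ≠ 0

/-- `X` is a predecessor of `Y`: there is a path `X = X₀ → X₁ → ⋯ → X_t = Y` of nonzero morphisms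
between indecomposable modules. -/
def IsPredecessor (X Y : ModuleCat.{u} Aᵐᵒᵖ) : Prop :=
  Relation.TransGen (IndStep A) X Y

/-- The left part of the module category of `A`: the indecomposable modules all of whose
predecessors have projective dimension at most one. -/
def leftPart (X : ModuleCat.{u} Aᵐᵒᵖ) : Prop :=
  Ind A X ∧ ∀ Y, IsPredecessor A Y X → HasProjectiveDimensionLE Y 1

variable {A}

/-- Isomorphism, as an equivalence relation on the projective modules in a class `C`. -/
def projSetoid (C : ModuleCat.{u} Aᵐᵒᵖ → Prop) :
    Setoid {X : ModuleCat.{u} Aᵐᵒᵖ // C X ∧ Module.Projective Aᵐᵒᵖ X} where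
  r X Y := Nonempty (X.1 ≅ Y.1)
  iseqv := ⟨fun _ => ⟨Iso.refl _⟩, fun ⟨f⟩ => ⟨f.symm⟩, fun ⟨f⟩ ⟨g⟩ => ⟨f.trans g⟩⟩

/-- The supporting projective of a class `C` of indecomposable modules: the direct sum of all
projective modules in `C`, one from each isomorphism class. -/
abbrev SupportingProjective (C : ModuleCat.{u} Aᵐᵒᵖ → Prop) : Type (u + 1) :=
  DirectSum (Quotient (projSetoid C)) fun c => c.out.1

variable (A)

/-- The left support of `A`: the endomorphism ring of the supporting projective of the left
part. -/
abbrev LeftSupport : Type (u + 1) :=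
  Module.End Aᵐᵒᵖ (SupportingProjective (leftPart A))

variable {A}

/-- For a `k`-algebra `A`, the endomorphism ring of a right `A`-module is a `k`-algebra in the usual
way: `c ∈ k` acts as the endomorphism `x ↦ x · c`. -/
noncomputable instance endAlgebra {k : Type v} [CommRing k] [Algebra k A]
    (C : ModuleCat.{u} Aᵐᵒᵖ → Prop) : Algebra k (Module.End Aᵐᵒᵖ (SupportingProjective C)) :=
  RingHom.toAlgebra'
    { toFun c :=
        { toFun x := algebraMap k Aᵐᵒᵖ c • x
          map_add' x y := smul_add _ x y
          map_smul' a x := by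
            rw [RingHom.id_apply, smul_smul, smul_smul, Algebra.commutes] }
      map_one' := by ext1 x; simp
      map_mul' a b := by ext1 x; simp [mul_smul]
      map_zero' := by ext1 x; simp
      map_add' a b := by ext1 x; simp [add_smul] }
    (fun c f => by
      apply LinearMap.ext
      intro x
      exact (map_smul f (algebraMap k Aᵐᵒᵖ c) x).symm)

end LeftSupport

/-! As a right module, `A` is the direct sum of its first row `(H, 0) = eA` and its second row `(M,
R)`.

Submodules of the first row are right ideals of `H`, hence projective. So an indecomposable module
with a nonzero map to such a submodule has projective image, splits over it, and embeds in the first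
row itself. By induction along paths, all predecessors of an indecomposable submodule of `eA` are
projective (`leftPart_of_injective`).

The second row has endomorphism ring `R`, which is local. For a nonzero nonunit `r`, the image of
left multiplication by `r` is an indecomposable predecessor of the second row. If its projective
dimension were at most one, the kernel would be projective, which nilpotency of the radical of `R`
forbids (`not_projective_ker_rowMul`). So the second row is not in the left part.

By Krull–Schmidt exchange, one summand in the basic decomposition of `A` is the second row and the
others add up to `eA`. These others, each occurring once, represent the projectives in the left
part. Hence `P ≅ eA`, and `End(eA) = H` acts by left multiplication. -/

section Generic

/-! ### Indecomposable modules, local endomorphism rings and exchange -/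

variable {S : Type u} [Ring S]

theorem indecomposable_iff_idempotents (X : ModuleCat.{u} S) :
    Indecomposable X ↔ Nontrivial X ∧ ∀ π : Module.End S X, π * π = π → π = 0 ∨ π = 1 := by
  have hz : ∀ Y : ModuleCat.{u} S, Limits.IsZero Y ↔ Subsingleton Y := fun Y =>
    ModuleCat.isZero_iff_subsingleton
  constructor
  · rintro ⟨h0, h⟩
    rw [hz, not_subsingleton_iff_nontrivial] at h0
    refine ⟨h0, fun π hπ => ?_⟩
    have hc : IsCompl (LinearMap.range π) (LinearMap.ker π) :=
      LinearMap.IsIdempotentElem.isCompl hπ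
    have i : X ≅ ModuleCat.of S (LinearMap.range π) ⊞ ModuleCat.of S (LinearMap.ker π) :=
      (Submodule.prodEquivOfIsCompl _ _ hc).symm.toModuleIso ≪≫
      (ModuleCat.biprodIsoProd (ModuleCat.of S (LinearMap.range π))
        (ModuleCat.of S (LinearMap.ker π))).symm
    rcases h _ _ i with h1 | h1
    · left
      rw [hz] at h1
      exact LinearMap.range_eq_bot.mp ((Submodule.subsingleton_iff_eq_bot).mp h1)
    · right
      rw [hz] at h1
      have hk := LinearMap.ker_eq_bot.mp ((Submodule.subsingleton_iff_eq_bot).mp h1)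
      ext x
      exact hk (LinearMap.congr_fun hπ x)
  · rintro ⟨h0, h⟩
    refine ⟨by rwa [hz, not_subsingleton_iff_nontrivial], fun Y Z i => ?_⟩
    have key : (i.hom ≫ Limits.biprod.fst ≫ Limits.biprod.inl ≫ i.inv) ≫
        (i.hom ≫ Limits.biprod.fst ≫ Limits.biprod.inl ≫ i.inv) =
        i.hom ≫ Limits.biprod.fst ≫ Limits.biprod.inl ≫ i.inv := by simp
    rcases h (i.hom ≫ Limits.biprod.fst ≫ Limits.biprod.inl ≫ i.inv).hom
      (congrArg ModuleCat.Hom.hom key) with h1 | h1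
    · left
      have h2 : i.hom ≫ Limits.biprod.fst ≫ Limits.biprod.inl ≫ i.inv = 0 := ModuleCat.hom_ext h1
      rw [Limits.IsZero.iff_id_eq_zero]
      have h3 := congrArg
        (fun t => Limits.biprod.inl ≫ i.inv ≫ t ≫ i.hom ≫ Limits.biprod.fst) h2
      simpa using h3
    · right
      have h2 : i.hom ≫ Limits.biprod.fst ≫ Limits.biprod.inl ≫ i.inv = 𝟙 X :=
        ModuleCat.hom_ext h1
      rw [Limits.IsZero.iff_id_eq_zero]
      have h3 := congrArg
        (fun t => Limits.biprod.inr ≫ i.inv ≫ t ≫ i.hom ≫ Limits.biprod.snd) h2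
      simpa using h3.symm

/-- The endomorphism ring of an indecomposable module of finite length is local. -/
theorem isLocalRing_end_of_indecomposable {X : ModuleCat.{u} S} [IsArtinian S X] [IsNoetherian S X]
    (h : Indecomposable X) : IsLocalRing (Module.End S X) := by
  obtain ⟨h0, hid⟩ := (indecomposable_iff_idempotents X).mp h
  refine IsLocalRing.of_isUnit_or_isUnit_one_sub_self fun f => ?_
  -- Fitting's lemma: the module splits as kernel plus range of a high power of `f`. The exponent is
  -- taken to be a successor so that invertibility of the power gives that of `f`.
  obtain ⟨n, hn⟩ := Filter.eventually_atTop.mp f.eventually_isCompl_ker_pow_range_pow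
  have hc := hn (n + 1) (by omega)
  set p : Module.End S X := Submodule.projection _ _ hc.symm with hp
  have hpid : p * p = p := Submodule.isIdempotentElem_projection hc.symm
  have hker : LinearMap.ker p = LinearMap.ker (f ^ (n + 1)) := Submodule.ker_projection hc.symm
  have hrange : LinearMap.range p = LinearMap.range (f ^ (n + 1)) := Submodule.range_projection hc.symm
  rcases hid p hpid with h1 | h1
  · right
    have : IsNilpotent f := ⟨n + 1, by
      rw [← LinearMap.range_eq_bot, ← hrange, h1, LinearMap.range_zero]⟩
    exact this.isUnit_one_sub
  · left
    rw [← isUnit_pow_succ_iff (n := n), Module.End.isUnit_iff]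
    refine ⟨LinearMap.ker_eq_bot.mp ?_, LinearMap.range_eq_top.mp ?_⟩
    · rw [← hker, h1]; exact LinearMap.ker_id
    · rw [← hrange, h1]; exact LinearMap.range_id

theorem IsLocalRing.isUnit_or_isUnit_of_add {E : Type*} [Ring E] [IsLocalRing E] {a b : E}
    (h : IsUnit (a + b)) : IsUnit a ∨ IsUnit b := by
  obtain ⟨w, hw⟩ := h
  have : (↑w⁻¹ : E) * a + ↑w⁻¹ * b = 1 := by rw [← mul_add, ← hw, Units.inv_mul]
  rcases IsLocalRing.isUnit_or_isUnit_of_add_one this with h | h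
  · left; exact (Units.isUnit_units_mul _ _).mp h
  · right; exact (Units.isUnit_units_mul _ _).mp h

theorem IsLocalRing.exists_isUnit_of_sum {E : Type*} [Ring E] [IsLocalRing E] {ι : Type*}
    (s : Finset ι) (f : ι → E) (h : IsUnit (∑ i ∈ s, f i)) : ∃ i ∈ s, IsUnit (f i) := by
  classical
  induction s using Finset.induction_on with
  | empty => simp at h
  | insert i s hi ih =>
    rw [Finset.sum_insert hi] at h
    rcases IsLocalRing.isUnit_or_isUnit_of_add h with h | h
    · exact ⟨i, by simp, h⟩
    · obtain ⟨j, hj, hu⟩ := ih h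
      exact ⟨j, by simp [hj], hu⟩

/-- After correction by a unit, `b` is a left inverse of `a`, so `a ∘ b` becomes an idempotent of
the indecomposable `P`. It is nonzero since `X` is, hence it is the identity. -/
theorem bijective_of_isUnit_comp {X : Type*} [AddCommGroup X] [Module S X] [Nontrivial X]
    {P : ModuleCat.{u} S} (hP : Indecomposable P) (a : X →ₗ[S] P) (b : P →ₗ[S] X)
    (h : IsUnit (b ∘ₗ a : Module.End S X)) : Function.Bijective a := by
  obtain ⟨w, hw⟩ := h
  set b' : P →ₗ[S] X := (↑w⁻¹ : Module.End S X) ∘ₗ b with hb'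
  have h1 : ∀ x, b' (a x) = x := fun x => by
    have : (↑w⁻¹ : Module.End S X) * (b ∘ₗ a : Module.End S X) = 1 := by rw [← hw, Units.inv_mul]
    exact LinearMap.congr_fun this x
  have hinj : Function.Injective a := Function.LeftInverse.injective h1
  rcases ((indecomposable_iff_idempotents P).mp hP).2 (a ∘ₗ b')
    (by ext x; simp [Module.End.mul_apply, h1]) with h2 | h2
  · exfalso
    obtain ⟨x, hx⟩ := exists_ne (0 : X)
    have := LinearMap.congr_fun h2 (a x)
    simp only [LinearMap.comp_apply, h1, LinearMap.zero_apply] at this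
    exact hx (hinj (by rw [this, map_zero]))
  · exact ⟨hinj, fun y => ⟨b' y, LinearMap.congr_fun h2 y⟩⟩

/-- A nonzero quotient of a projective module with local endomorphism ring is indecomposable. -/
theorem indecomposable_of_surjective {P : Type*} [AddCommGroup P] [Module S P]
    [Module.Projective S P] [IsLocalRing (Module.End S P)] {X : ModuleCat.{u} S} [Nontrivial X]
    (q : P →ₗ[S] X) (hq : Function.Surjective q) : Indecomposable X := by
  rw [indecomposable_iff_idempotents]
  refine ⟨inferInstance, fun π hπ => ?_⟩
  obtain ⟨g, hg⟩ := Module.projective_lifting_property q (π ∘ₗ q) hq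
  have hg' : ∀ x, q (g x) = π (q x) := fun x => LinearMap.congr_fun hg x
  -- One of the lifts `g` of `π` and `1 - g` of `1 - π` is invertible, so `π` or `1 - π` is a
  -- surjective idempotent, that is, the identity.
  rcases IsLocalRing.isUnit_or_isUnit_of_add_one (add_sub_cancel g 1) with h | h
  · right
    have hs := ((Module.End.isUnit_iff _).mp h).2
    ext x
    obtain ⟨y, rfl⟩ := hq x
    obtain ⟨z, rfl⟩ := hs y
    rw [hg']
    exact LinearMap.congr_fun hπ _
  · left
    have hs := ((Module.End.isUnit_iff _).mp h).2
    ext x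
    obtain ⟨y, rfl⟩ := hq x
    obtain ⟨z, rfl⟩ := hs y
    have := LinearMap.congr_fun hπ (q z)
    simp only [Module.End.mul_apply] at this
    simp [hg', this]

/-- If the regular module is a finite direct sum of indecomposables `P i`, then every
indecomposable projective module of finite length is isomorphic to some `P i`. -/
theorem exists_equiv_of_projective {ι : Type*} [Fintype ι] {F : Type u} [AddCommGroup F]
    [Module S F] (w : S ≃ₗ[S] F) (P : ι → Submodule S F)
    (s : ∀ i, F →ₗ[S] P i) (hs : ∀ x, ∑ i, (s i x : F) = x)
    (hP : ∀ i, Indecomposable (ModuleCat.of S (P i)))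
    {X : ModuleCat.{u} S} [IsArtinian S X] [IsNoetherian S X] [Module.Projective S X]
    (hX : Indecomposable X) : ∃ i, Nonempty (X ≃ₗ[S] P i) := by
  have := isLocalRing_end_of_indecomposable hX
  have : Nontrivial X := ((indecomposable_iff_idempotents X).mp hX).1
  obtain ⟨n, f, g, -, -, hfg⟩ := Module.Finite.exists_comp_eq_id_of_projective S X
  -- The identity of `X` factors through `Sⁿ`, hence is a sum of maps through the modules `P i`. As
  -- `End X` is local, one of these maps is invertible.
  have hsum : ∑ c : Fin n × ι, ((f ∘ₗ LinearMap.single S (fun _ => S) c.1 ∘ₗ w.symm.toLinearMap ∘ₗ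
      (P c.2).subtype) ∘ₗ (s c.2 ∘ₗ w.toLinearMap ∘ₗ LinearMap.proj c.1 ∘ₗ g)
        : Module.End S X) = 1 := by
    ext x
    rw [Fintype.sum_prod_type, LinearMap.sum_apply]
    simp only [LinearMap.sum_apply, LinearMap.comp_apply, Submodule.subtype_apply,
      LinearEquiv.coe_coe, LinearMap.proj_apply]
    simp only [← map_sum, hs, LinearEquiv.symm_apply_apply]
    have hg : ∑ j, LinearMap.single S (fun _ : Fin n => S) j (g x j) = g x :=
      Finset.univ_sum_single (g x)
    rw [hg]
    exact LinearMap.congr_fun hfg x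
  obtain ⟨c, -, hc⟩ := IsLocalRing.exists_isUnit_of_sum _ _ (hsum ▸ isUnit_one)
  have hb := bijective_of_isUnit_comp (hP c.2)
    (s c.2 ∘ₗ w.toLinearMap ∘ₗ LinearMap.proj c.1 ∘ₗ g) _ hc
  exact ⟨c.2, ⟨LinearEquiv.ofBijective _ hb⟩⟩

/-- If `P` is a finite direct sum decomposition of `F` with projections `s`, then a submodule `K`
on which the projection to the `j`-th summand is bijective is a complement of the other summands. -/
theorem nonempty_equiv_directSum_of_bijective {ι : Type*} [Fintype ι] [DecidableEq ι] {F : Type*}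
    [AddCommGroup F] [Module S F] (P : ι → Submodule S F)
    (s : ∀ i, F →ₗ[S] P i) (hs : ∀ x, ∑ i, (s i x : F) = x)
    (h_same : ∀ i (x : P i), s i x = x) (h_diff : ∀ i j (x : P j), i ≠ j → s i x = 0)
    (j : ι) {K L : Submodule S F} (hKL : IsCompl K L)
    (hj : Function.Bijective (s j ∘ₗ K.subtype)) :
    Nonempty (L ≃ₗ[S] DirectSum {i // i ≠ j} fun i => P i) := by
  -- Both `L` and `ker (s j)` are complements of `K`, hence isomorphic to `F / K`.
  have hc : IsCompl K (LinearMap.ker (s j)) := by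
    constructor
    · rw [Submodule.disjoint_def]
      intro x hx hx'
      have := hj.1 (a₁ := ⟨x, hx⟩) (a₂ := 0) (by simpa using hx')
      simpa using this
    · rw [codisjoint_iff, eq_top_iff]
      intro x _
      obtain ⟨y, hy⟩ := hj.2 (s j x)
      have hy' : s j y = s j x := hy
      exact Submodule.mem_sup.mpr ⟨y, y.2, x - y, by simp [hy'], by simp⟩
  let g : LinearMap.ker (s j) →ₗ[S] (∀ i : {i // i ≠ j}, P i) :=
    LinearMap.pi fun i => s i ∘ₗ (LinearMap.ker (s j)).subtype
  have hg : Function.Bijective g := by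
    constructor
    · rw [← LinearMap.ker_eq_bot, LinearMap.ker_eq_bot']
      rintro ⟨x, hx⟩ h
      ext
      change x = 0
      rw [← hs x]
      refine Finset.sum_eq_zero fun i _ => ?_
      by_cases hi : i = j
      · subst hi
        simpa using hx
      · have := congrFun h ⟨i, hi⟩
        exact congrArg Subtype.val this
    · intro y
      have key : ∀ i, s i (∑ l : {i // i ≠ j}, (y l : F)) =
          ∑ l : {i // i ≠ j}, s i (y l : F) := fun i => map_sum _ _ _
      refine ⟨⟨∑ l : {i // i ≠ j}, (y l : F), ?_⟩, ?_⟩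
      · rw [LinearMap.mem_ker, key]
        exact Finset.sum_eq_zero fun l _ => h_diff _ _ _ l.2.symm
      · ext i
        change (s i (∑ l : {i // i ≠ j}, (y l : F)) : F) = y i
        rw [key, Finset.sum_eq_single i, h_same]
        · intro l _ hl
          exact h_diff _ _ _ fun h => hl (Subtype.ext h.symm)
        · simp
  exact ⟨(Submodule.quotientEquivOfIsCompl K L hKL).symm ≪≫ₗ
    Submodule.quotientEquivOfIsCompl K _ hc ≪≫ₗ LinearEquiv.ofBijective g hg ≪≫ₗ
    (DirectSum.linearEquivFunOnFintype S {i // i ≠ j} fun i => P i).symm⟩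

/-- An indecomposable module mapping onto a nonzero projective module is isomorphic to it. -/
theorem injective_of_projective_range {Y : ModuleCat.{u} S} (hY : Indecomposable Y) {F : Type*}
    [AddCommGroup F] [Module S F] (g : Y →ₗ[S] F) (hg : g ≠ 0)
    [Module.Projective S (LinearMap.range g)] : Function.Injective g := by
  obtain ⟨t, ht⟩ := Module.projective_lifting_property g.rangeRestrict LinearMap.id
    g.surjective_rangeRestrict
  have ht' : ∀ x, g.rangeRestrict (t x) = x := fun x => LinearMap.congr_fun ht x
  rcases ((indecomposable_iff_idempotents Y).mp hY).2 (t ∘ₗ g.rangeRestrict)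
    (by ext x; simp only [Module.End.mul_apply, LinearMap.comp_apply, ht']) with h | h
  · refine absurd ?_ hg
    ext x
    have := LinearMap.congr_fun h x
    have h2 := ht' (g.rangeRestrict x)
    simp only [LinearMap.comp_apply, LinearMap.zero_apply] at this
    rw [this, map_zero] at h2
    exact (congrArg Subtype.val h2).symm
  · intro x y hxy
    have h1 : g.rangeRestrict x = g.rangeRestrict y := Subtype.ext hxy
    have hx := LinearMap.congr_fun h x
    have hy := LinearMap.congr_fun h y
    simp only [LinearMap.comp_apply, Module.End.one_apply] at hx hy
    rw [← hx, ← hy, h1]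

theorem projective_ker_of_projectiveDimensionLE {P F : Type u} [AddCommGroup P] [Module S P]
    [AddCommGroup F] [Module S F] [Module.Projective S P] (q : P →ₗ[S] F)
    [HasProjectiveDimensionLE (ModuleCat.of S (LinearMap.range q)) 1] :
    Module.Projective S (LinearMap.ker q) := by
  let C : ShortComplex (ModuleCat.{u} S) :=
    ShortComplex.mk (X₁ := ModuleCat.of S (LinearMap.ker q)) (X₂ := ModuleCat.of S P)
      (X₃ := ModuleCat.of S (LinearMap.range q)) (ModuleCat.ofHom (LinearMap.ker q).subtype)
      (ModuleCat.ofHom q.rangeRestrict)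
      (ModuleCat.hom_ext (LinearMap.ext fun x : LinearMap.ker q =>
        Subtype.ext (LinearMap.mem_ker.mp x.2)))
  have hC : C.ShortExact :=
    { exact := by
        rw [ShortComplex.moduleCat_exact_iff]
        intro x hx
        exact ⟨⟨x, LinearMap.mem_ker.mpr (congrArg Subtype.val hx)⟩, rfl⟩
      mono_f := by
        rw [ModuleCat.mono_iff_injective]
        exact (LinearMap.ker q).subtype_injective
      epi_g := by
        rw [ModuleCat.epi_iff_surjective]
        exact q.surjective_rangeRestrict }
  have h2 : HasProjectiveDimensionLT C.X₂ 1 := by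
    rw [← projective_iff_hasProjectiveDimensionLT_one]
    exact (IsProjective.iff_projective (R := S) P).mp inferInstance
  have h1 := hC.hasProjectiveDimensionLT_X₁ 1 h2 ‹_›
  rw [← projective_iff_hasProjectiveDimensionLT_one] at h1
  exact (IsProjective.iff_projective (R := S) (LinearMap.ker q)).mpr h1

end Generic

/-! ### Units and radical of a noncommutative local ring -/

section Ring

variable {R : Type*} [Ring R] [IsLocalRing R]

/-- The product `a * b` is idempotent, so it is `0` or `1` in a local ring; the value `0` would give
`1 = (b * a) * (b * a) = 0`. -/
theorem IsLocalRing.isUnit_of_mul_eq_one {a b : R} (h : b * a = 1) : IsUnit a := by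
  have hid : (a * b) * (a * b) = a * b := by
    rw [mul_assoc, ← mul_assoc b, h, one_mul]
  rcases IsLocalRing.isUnit_or_isUnit_of_add_one (add_sub_cancel (a * b) 1) with hu | hu
  · exact ⟨⟨a, b, hu.mul_left_cancel (by rw [hid, mul_one]), h⟩, rfl⟩
  · have h0 : a * b = 0 := hu.mul_left_cancel (by rw [mul_zero, sub_mul, one_mul, hid, sub_self])
    have h1 : (1 : R) = 0 := by
      calc (1 : R) = (b * a) * (b * a) := by rw [h, one_mul]
        _ = b * (a * b) * a := by simp only [mul_assoc]
        _ = 0 := by rw [h0, mul_zero, zero_mul]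
    exact absurd h1 one_ne_zero

theorem IsLocalRing.mem_ringJacobson {a : R} (ha : ¬ IsUnit a) : a ∈ Ring.jacobson R := by
  rw [Ring.jacobson_eq_sInf_isMaximal, Ideal.mem_sInf]
  intro I hI
  by_contra hmem
  obtain ⟨y, i, hi, hy⟩ := Ideal.IsMaximal.exists_inv hI hmem
  rcases IsLocalRing.isUnit_or_isUnit_of_add_one hy with h | h
  · obtain ⟨w, hw⟩ := h
    exact ha (IsLocalRing.isUnit_of_mul_eq_one (b := ↑w⁻¹ * y)
      (by rw [mul_assoc, ← hw, Units.inv_mul]))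
  · exact hI.ne_top (Ideal.eq_top_of_isUnit_mem _ hi h)

end Ring

/-! ### Direct sum decompositions and representatives of projectives -/

section Decomposition

variable {S : Type u} [Ring S]

theorem DirectSum.IsInternal.exists_projections {ι : Type*} [Fintype ι] [DecidableEq ι]
    {F : Type*} [AddCommGroup F] [Module S F] {P : ι → Submodule S F}
    (hP : DirectSum.IsInternal P) :
    ∃ s : ∀ i, F →ₗ[S] P i, (∀ x, ∑ i, (s i x : F) = x) ∧ (∀ i (x : P i), s i x = x) ∧
      ∀ i j (x : P j), i ≠ j → s i x = 0 := by
  let d : DirectSum ι (fun i => P i) ≃ₗ[S] F :=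
    LinearEquiv.ofBijective (DirectSum.coeLinearMap P) hP
  have hd : ∀ i (x : P i), d.symm x = DirectSum.lof S ι (fun i => P i) i x := fun i x => by
    rw [LinearEquiv.symm_apply_eq]
    exact (DirectSum.coeLinearMap_lof P i x).symm
  refine ⟨fun i => DirectSum.component S ι (fun i => P i) i ∘ₗ d.symm.toLinearMap,
    fun x => ?_, fun i x => ?_, fun i j x hij => ?_⟩
  · obtain ⟨y, rfl⟩ := d.surjective x
    simp only [LinearMap.comp_apply, LinearEquiv.coe_coe, LinearEquiv.symm_apply_apply]
    change _ = DirectSum.coeLinearMap P y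
    conv_rhs => rw [← DirectSum.sum_univ_of y, map_sum]
    exact Finset.sum_congr rfl fun i _ => (DirectSum.coeLinearMap_of P i (y i)).symm
  · simp only [LinearMap.comp_apply, LinearEquiv.coe_coe, hd]
    rw [DirectSum.component.lof_self]
  · simp only [LinearMap.comp_apply, LinearEquiv.coe_coe, hd]
    rw [DirectSum.component.of, dif_neg hij.symm]

/-- The supporting projective of `C` is the direct sum of any family of representatives of the
projective modules in `C`. -/
theorem nonempty_supportingProjective_equiv {A : Type u} [Ring A]
    (C : ModuleCat.{u} Aᵐᵒᵖ → Prop) {ι : Type} (Q : ι → ModuleCat.{u} Aᵐᵒᵖ)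
    (hC : ∀ i, C (Q i)) (h_proj : ∀ i, Module.Projective Aᵐᵒᵖ (Q i))
    (h_ne : ∀ i j, i ≠ j → IsEmpty (Q i ≅ Q j))
    (h_all : ∀ X, C X → Module.Projective Aᵐᵒᵖ X → ∃ i, Nonempty (X ≅ Q i)) :
    Nonempty (SupportingProjective C ≃ₗ[Aᵐᵒᵖ] DirectSum ι fun i => Q i) := by
  have hb : Function.Bijective fun i : ι =>
      (⟦⟨Q i, hC i, h_proj i⟩⟧ : Quotient (projSetoid C)) := by
    constructor
    · intro i j h
      by_contra hij
      obtain ⟨f⟩ := Quotient.exact h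
      exact (h_ne i j hij).false f
    · intro c
      induction c using Quotient.inductionOn with
      | h X =>
        obtain ⟨i, ⟨f⟩⟩ := h_all X.1 X.2.1 X.2.2
        exact ⟨i, Quotient.sound ⟨f.symm⟩⟩
  let d := Equiv.ofBijective _ hb
  have f : ∀ i, (d i).out.1 ≅ Q i := fun i =>
    Classical.choice (Quotient.exact (Quotient.out_eq (d i)))
  exact ⟨DirectSum.lequivCongrLeft Aᵐᵒᵖ d.symm ≪≫ₗ
    DFinsupp.mapRange.linearEquiv fun i => (f i).toLinearEquiv⟩

end Decomposition

/-! ### The two rows of the triangular matrix ring -/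

namespace TriMatrix

theorem inl_add {H M R : Type u} [Ring H] [AddCommGroup M] [Ring R]
    (h h' : H) : inl M R (h + h') = inl M R h + inl M R h' := by
  ext <;> simp [inl]

variable {H M R : Type u} [Ring H] [AddCommGroup M] [Ring R] [Module R M] [Module Hᵐᵒᵖ M]

theorem inl_mul (h : H) (a : TriMatrix H M R) : inl M R h * a = inl M R (h * a.h) := by
  ext <;> simp [inl]

variable [SMulCommClass R Hᵐᵒᵖ M]

theorem op_smul (a x : TriMatrix H M R) : MulOpposite.op a • x = x * a := rfl

theorem mem_firstRow {x : TriMatrix H M R} : x ∈ firstRow H M R ↔ x.m = 0 ∧ x.r = 0 := by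
  rw [firstRow, Submodule.mem_span_singleton]
  constructor
  · rintro ⟨a, rfl⟩
    induction a using MulOpposite.rec' with
    | h a => simp [e]
  · rintro ⟨h1, h2⟩
    exact ⟨MulOpposite.op x, by rw [op_smul]; ext <;> simp [e, h1, h2]⟩

variable (H M R) in
/-- The second row `(M, R)` of the triangular matrix ring. -/
def secondRow : Submodule (TriMatrix H M R)ᵐᵒᵖ (TriMatrix H M R) where
  carrier := {x | x.h = 0}
  add_mem' {x y} (hx : x.h = 0) (hy : y.h = 0) := by
    change x.h + y.h = 0
    rw [hx, hy, add_zero]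
  zero_mem' := rfl
  smul_mem' a x (hx : x.h = 0) := by
    change x.h * _ = 0
    rw [hx, zero_mul]

theorem mem_secondRow {x : TriMatrix H M R} : x ∈ secondRow H M R ↔ x.h = 0 := Iff.rfl

theorem isCompl_rows : IsCompl (secondRow H M R) (firstRow H M R) := by
  constructor
  · rw [Submodule.disjoint_def]
    intro x hx hx'
    rw [mem_firstRow] at hx'
    ext
    · exact hx
    · exact hx'.1
    · exact hx'.2
  · rw [codisjoint_iff, eq_top_iff]
    intro x _
    refine Submodule.mem_sup.mpr ⟨⟨0, x.m, x.r⟩, rfl, ⟨x.h, 0, 0⟩, mem_firstRow.mpr ⟨rfl, rfl⟩, ?_⟩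
    ext <;> simp

/-- The regular right module. -/
def opEquiv (A : Type u) [Ring A] : Aᵐᵒᵖ ≃ₗ[Aᵐᵒᵖ] A where
  toFun := MulOpposite.unop
  invFun := MulOpposite.op
  left_inv _ := rfl
  right_inv _ := rfl
  map_add' _ _ := rfl
  map_smul' _ _ := rfl

theorem projective_of_isCompl {A : Type u} [Ring A] {K L : Submodule Aᵐᵒᵖ A} (h : IsCompl K L) :
    Module.Projective Aᵐᵒᵖ K := by
  have : Module.Projective Aᵐᵒᵖ A := Module.Projective.of_equiv' (opEquiv A)
  exact Module.Projective.of_split K.subtype (K.projectionOnto L h)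
    (Submodule.projectionOnto_comp_subtype h)

/-- Left multiplication by `[[0, 0], [0, r]]` on the second row. -/
def rowMul (r : R) : Module.End (TriMatrix H M R)ᵐᵒᵖ (secondRow H M R) where
  toFun x := ⟨⟨0, 0, r⟩ * x.1, by simp [mem_secondRow]⟩
  map_add' x y := Subtype.ext (mul_add _ _ _)
  map_smul' a x := Subtype.ext (mul_assoc _ _ _).symm

theorem coe_rowMul (r : R) (x : secondRow H M R) :
    (rowMul r x : TriMatrix H M R) = ⟨0, r • x.1.m, r * x.1.r⟩ := by
  ext <;> simp [rowMul]

theorem rowMul_mul (r s : R) :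
    (rowMul (r * s) : Module.End (TriMatrix H M R)ᵐᵒᵖ (secondRow H M R)) =
      rowMul r * rowMul s := by
  ext x <;> simp [coe_rowMul, Module.End.mul_apply, mul_smul, mul_assoc]

theorem rowMul_one : (rowMul 1 : Module.End (TriMatrix H M R)ᵐᵒᵖ (secondRow H M R)) = 1 := by
  ext x
  · simpa [coe_rowMul] using (mem_secondRow.mp x.2).symm
  · simp [coe_rowMul]
  · simp [coe_rowMul]

theorem rowMul_add (r s : R) :
    (rowMul (r + s) : Module.End (TriMatrix H M R)ᵐᵒᵖ (secondRow H M R)) =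
      rowMul r + rowMul s := by
  ext x <;> simp [coe_rowMul, add_smul, add_mul]

variable (H M) in
/-- The lower right idempotent, as an element of the second row. -/
def secondUnit : secondRow H M R := ⟨⟨0, 0, 1⟩, rfl⟩

theorem smul_secondUnit (x : secondRow H M R) : MulOpposite.op x.1 • secondUnit H M = x := by
  ext
  · simpa [secondUnit] using (mem_secondRow.mp x.2).symm
  · simp [secondUnit]
  · simp [secondUnit]

theorem rowMul_surjective (f : Module.End (TriMatrix H M R)ᵐᵒᵖ (secondRow H M R)) :
    ∃ r, f = rowMul r := by
  refine ⟨(f (secondUnit H M)).1.r, LinearMap.ext fun x => ?_⟩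
  -- The generator is idempotent, so its image is fixed by right multiplication with it, which kills
  -- the `M`-entry.
  have h1 : f (secondUnit H M) = MulOpposite.op (secondUnit (R := R) H M).1 • f (secondUnit H M) := by
    rw [← map_smul, smul_secondUnit]
  have h2 : (f (secondUnit H M)).1.m = 0 := by
    rw [h1]
    simp [secondUnit]
  rw [← smul_secondUnit x, map_smul, map_smul]
  congr 1
  ext
  · rw [coe_rowMul]
    exact (f (secondUnit H M)).2
  · rw [coe_rowMul, h2]
    simp [secondUnit]
  · simp [coe_rowMul, secondUnit]

instance [Nontrivial R] : Nontrivial (secondRow H M R) :=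
  ⟨secondUnit H M, 0, fun h => one_ne_zero (congrArg (fun x => x.1.r) h : (1 : R) = 0)⟩

theorem isUnit_rowMul {r : R} (hr : IsUnit r) :
    IsUnit (rowMul r : Module.End (TriMatrix H M R)ᵐᵒᵖ (secondRow H M R)) := by
  obtain ⟨w, rfl⟩ := hr
  exact ⟨⟨rowMul w, rowMul ↑w⁻¹, by rw [← rowMul_mul, Units.mul_inv, rowMul_one],
    by rw [← rowMul_mul, Units.inv_mul, rowMul_one]⟩, rfl⟩

instance isLocalRing_end_secondRow [IsLocalRing R] :
    IsLocalRing (Module.End (TriMatrix H M R)ᵐᵒᵖ (secondRow H M R)) := by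
  refine ⟨fun {f g} hfg => ?_⟩
  obtain ⟨r, rfl⟩ := rowMul_surjective f
  obtain ⟨t, rfl⟩ := rowMul_surjective g
  have h1 : r + t = 1 := by
    rw [← rowMul_add] at hfg
    have := congrArg (fun y => y.1.r) (LinearMap.congr_fun hfg (secondUnit H M))
    simpa [coe_rowMul, secondUnit] using this
  exact (IsLocalRing.isUnit_or_isUnit_of_add_one h1).imp isUnit_rowMul isUnit_rowMul

instance projective_secondRow : Module.Projective (TriMatrix H M R)ᵐᵒᵖ (secondRow H M R) :=
  projective_of_isCompl isCompl_rows

/-! ### Submodules of the first row and the left part -/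

variable (M R) in
theorem inl_mem_firstRow (h : H) : inl M R h ∈ firstRow H M R := mem_firstRow.mpr ⟨rfl, rfl⟩

theorem inl_of_mem_firstRow {x : TriMatrix H M R} (hx : x ∈ firstRow H M R) : inl M R x.h = x := by
  rw [mem_firstRow] at hx
  ext
  · rfl
  · exact hx.1.symm
  · exact hx.2.symm

/-- If `H` is hereditary then all submodules of the first row are projective. -/
theorem projective_of_le_firstRow (hH : IsRightHereditary H)
    {N : Submodule (TriMatrix H M R)ᵐᵒᵖ (TriMatrix H M R)} (hN : N ≤ firstRow H M R) :
    Module.Projective (TriMatrix H M R)ᵐᵒᵖ N := by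
  let I : Submodule Hᵐᵒᵖ H :=
    { carrier := {h | inl M R h ∈ N}
      add_mem' {a b} (ha : inl M R a ∈ N) (hb : inl M R b ∈ N) := by
        change inl M R (a + b) ∈ N
        rw [inl_add]
        exact N.add_mem ha hb
      zero_mem' := N.zero_mem
      smul_mem' c h (hh : inl M R h ∈ N) := by
        change inl M R (h * c.unop) ∈ N
        have := N.smul_mem (MulOpposite.op (inl M R c.unop)) hh
        rwa [op_smul, inl_mul] at this }
  have hI : ∀ x : N, x.1.h ∈ I := fun x => by
    change inl M R x.1.h ∈ N
    rw [inl_of_mem_firstRow (hN x.2)]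
    exact x.2
  let incl : I →+ N :=
    { toFun h := ⟨inl M R h.1, h.2⟩
      map_zero' := rfl
      map_add' a b := Subtype.ext (inl_add _ _) }
  let coef : Hᵐᵒᵖ →+ (TriMatrix H M R)ᵐᵒᵖ :=
    { toFun c := MulOpposite.op (inl M R c.unop)
      map_zero' := rfl
      map_add' a b := congrArg MulOpposite.op (inl_add _ _) }
  -- A matrix `a` acts on the first row only through `a.h`. Hence `T`, semilinear along `a ↦ a.h`,
  -- carries an `H`-linear section of the free cover of `I` to an `A`-linear section of the free
  -- cover of `N`.
  have coef_mul : ∀ (a : TriMatrix H M R) (c : Hᵐᵒᵖ),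
      coef (MulOpposite.op a.h * c) = MulOpposite.op a * coef c := fun a c =>
    congrArg MulOpposite.op (inl_mul c.unop a).symm
  let T : (I →₀ Hᵐᵒᵖ) →+ (N →₀ (TriMatrix H M R)ᵐᵒᵖ) :=
    (Finsupp.mapDomain.addMonoidHom incl).comp (Finsupp.mapRange.addMonoidHom coef)
  have T_single : ∀ i c, T (Finsupp.single i c) = Finsupp.single (incl i) (coef c) := fun i c => by
    simp [T]
  have T_smul : ∀ (a : TriMatrix H M R) (v : I →₀ Hᵐᵒᵖ),
      T (MulOpposite.op a.h • v) = MulOpposite.op a • T v := fun a v => by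
    induction v using Finsupp.induction_linear with
    | zero => simp
    | add f g hf hg => rw [smul_add, map_add, hf, hg, map_add, smul_add]
    | single i c =>
      rw [Finsupp.smul_single, T_single, T_single, Finsupp.smul_single, smul_eq_mul, coef_mul,
        smul_eq_mul]
  have T_comb : ∀ v, Finsupp.linearCombination (TriMatrix H M R)ᵐᵒᵖ id (T v) =
      incl (Finsupp.linearCombination Hᵐᵒᵖ id v) := fun v => by
    induction v using Finsupp.induction_linear with
    | zero => simp
    | add f g hf hg => simp only [map_add, hf, hg]
    | single i c =>
      rw [T_single, Finsupp.linearCombination_single, Finsupp.linearCombination_single]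
      exact Subtype.ext (inl_mul _ _)
  obtain ⟨s, hs⟩ := (hH I).out
  refine ⟨⟨{ toFun x := T (s ⟨x.1.h, hI x⟩), map_add' := ?_, map_smul' := ?_ }, ?_⟩⟩
  · intro x y
    rw [← map_add, ← map_add]
    rfl
  · intro a x
    rw [RingHom.id_apply, ← MulOpposite.op_unop a, ← T_smul, ← map_smul]
    rfl
  · intro x
    change Finsupp.linearCombination _ id (T (s ⟨x.1.h, hI x⟩)) = x
    rw [T_comb, hs]
    exact Subtype.ext (inl_of_mem_firstRow (hN x.2))

theorem moduleFinite {k : Type v} [CommRing k] [Algebra k H] [Algebra k R] [Module k M]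
    [IsScalarTower k R M] [IsScalarTower k Hᵐᵒᵖ M] [Module.Finite k H] [Module.Finite k M]
    [Module.Finite k R] : Module.Finite k (TriMatrix H M R) :=
  Module.Finite.equiv (M := H × M × R)
    { (equivProd H M R).symm with
      map_add' := fun _ _ => rfl
      map_smul' := fun _ _ => rfl }

/-- If `H` is hereditary then an indecomposable module with a nonzero map to a submodule of the
first row is itself isomorphic to a submodule of the first row. -/
theorem exists_injective_of_indStep (hH : IsRightHereditary H)
    {X Y : ModuleCat.{u} (TriMatrix H M R)ᵐᵒᵖ} (hYX : IndStep (TriMatrix H M R) Y X)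
    (hX : ∃ j : X →ₗ[(TriMatrix H M R)ᵐᵒᵖ] TriMatrix H M R,
      Function.Injective j ∧ LinearMap.range j ≤ firstRow H M R) :
    ∃ j : Y →ₗ[(TriMatrix H M R)ᵐᵒᵖ] TriMatrix H M R,
      Function.Injective j ∧ LinearMap.range j ≤ firstRow H M R := by
  obtain ⟨hY, -, f, hf⟩ := hYX
  obtain ⟨j, hj, hjr⟩ := hX
  have hr : LinearMap.range (j ∘ₗ f.hom) ≤ firstRow H M R :=
    (LinearMap.range_comp_le_range _ _).trans hjr
  have := projective_of_le_firstRow hH hr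
  refine ⟨j ∘ₗ f.hom, injective_of_projective_range hY.2 _ fun h => hf ?_, hr⟩
  ext x
  exact hj (by simpa using LinearMap.congr_fun h x)

theorem projective_of_injective (hH : IsRightHereditary H) {X : Type*} [AddCommGroup X]
    [Module (TriMatrix H M R)ᵐᵒᵖ X]
    (hX : ∃ j : X →ₗ[(TriMatrix H M R)ᵐᵒᵖ] TriMatrix H M R,
      Function.Injective j ∧ LinearMap.range j ≤ firstRow H M R) :
    Module.Projective (TriMatrix H M R)ᵐᵒᵖ X := by
  obtain ⟨j, hj, hjr⟩ := hX
  have := projective_of_le_firstRow hH hjr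
  exact Module.Projective.of_equiv' (LinearEquiv.ofInjective j hj).symm

/-- If `H` is hereditary then the indecomposable submodules of the first row are in the left
part. -/
theorem leftPart_of_injective (hH : IsRightHereditary H)
    {X : ModuleCat.{u} (TriMatrix H M R)ᵐᵒᵖ} (hX : Ind (TriMatrix H M R) X)
    (hj : ∃ j : X →ₗ[(TriMatrix H M R)ᵐᵒᵖ] TriMatrix H M R,
      Function.Injective j ∧ LinearMap.range j ≤ firstRow H M R) :
    leftPart (TriMatrix H M R) X := by
  refine ⟨hX, fun Y hY => ?_⟩
  have hY' : ∃ j : Y →ₗ[(TriMatrix H M R)ᵐᵒᵖ] TriMatrix H M R,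
      Function.Injective j ∧ LinearMap.range j ≤ firstRow H M R := by
    induction hY using Relation.TransGen.head_induction_on with
    | single h => exact exists_injective_of_indStep hH h hj
    | head h _ ih => exact exists_injective_of_indStep hH h ih
  have := projective_of_injective hH hY'
  rw [IsProjective.iff_projective, projective_iff_hasProjectiveDimensionLT_one] at this
  exact hasProjectiveDimensionLT_of_ge Y 1 2 (by norm_num)

/-! ### The second row lies outside the left part -/

/-- If the Jacobson radical of the local ring `R` is nilpotent, then no nonzero nonunit of `R` has
projective annihilator in the second row. -/
theorem not_projective_ker_rowMul [IsLocalRing R] (hnil : IsNilpotent (Ring.jacobson R)) {r : R}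
    (h0 : r ≠ 0) (hu : ¬ IsUnit r) :
    ¬ Module.Projective (TriMatrix H M R)ᵐᵒᵖ
      (LinearMap.ker (rowMul r : Module.End (TriMatrix H M R)ᵐᵒᵖ (secondRow H M R))) := by
  intro hp
  set K := LinearMap.ker (rowMul r : Module.End (TriMatrix H M R)ᵐᵒᵖ (secondRow H M R))
  obtain ⟨n, hn⟩ := hnil
  have pow_mem : ∀ x ∈ Ring.jacobson R, ∀ m, x ^ m ∈ Ring.jacobson R ^ m := fun x hx m => by
    induction m with
    | zero => rw [Submodule.pow_zero, Ideal.one_eq_top]; exact Submodule.mem_top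
    | succ m ih => rw [pow_succ, Submodule.pow_succ]; exact Ideal.mul_mem_mul ih hx
  have nil : ∀ x : R, ¬ IsUnit x → x ^ n = 0 := fun x hx => by
    have := pow_mem x (IsLocalRing.mem_ringJacobson hx) n
    rwa [hn] at this
  have hK : ∀ x : K, r * x.1.1.r = 0 := fun x => by
    have h : rowMul r x.1 = 0 := x.2
    have := coe_rowMul r x.1
    rw [h] at this
    exact (congrArg TriMatrix.r this).symm
  have hKu : ∀ x : K, ¬ IsUnit x.1.1.r := fun x h => by
    refine h0 (h.mul_right_cancel ?_)
    rw [hK, zero_mul]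
  obtain ⟨s, hs⟩ := hp.out
  have hs' : ∀ x : K, x = (s x).sum fun y c => c • y := fun x => (hs x).symm
  -- `s` splits the free cover of `K`. If some coefficient of some `s x` has a unit `R`-entry `u`,
  -- then `x · a = 0` forces `u * a.r = 0`. Taking for `a.r` powers of the nilpotent `R`-entry of
  -- `x` descends to `1 = 0`.
  by_cases hunit : ∃ x y : K, IsUnit ((s x) y).unop.r
  · obtain ⟨x, y, hxy⟩ := hunit
    have step : ∀ m, x.1.1.r ^ (m + 1) = 0 → x.1.1.r ^ m = 0 := fun m hm => by
      have h1 : MulOpposite.op (⟨0, 0, x.1.1.r ^ m⟩ : TriMatrix H M R) • x = 0 := by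
        apply Subtype.ext
        apply Subtype.ext
        change x.1.1 * (⟨0, 0, x.1.1.r ^ m⟩ : TriMatrix H M R) = 0
        ext
        · simp
        · simp
        · simpa [pow_succ'] using hm
      have h2 := congrArg (fun v => (v y).unop.r) (congrArg s h1)
      simp only [map_smul, map_zero, Finsupp.smul_apply, smul_eq_mul, MulOpposite.unop_mul,
        MulOpposite.unop_op, mul_r, Finsupp.zero_apply, MulOpposite.unop_zero, zero_r] at h2
      exact hxy.mul_left_cancel (by rw [h2, mul_zero])
    have : ∀ m, x.1.1.r ^ m = 0 → False := fun m => by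
      induction m with
      | zero => simp
      | succ m ih => exact fun h => ih (step m h)
    exact this n (nil _ (hKu x))
  · push Not at hunit
    -- Otherwise all coefficients have `R`-entry in the radical. Writing each `x` in `K` as a
    -- combination of elements of `K` pushes its `R`-entry into every power of the radical, so it
    -- vanishes.
    have hpow : ∀ m, ∀ x : K, x.1.1.r ∈ Ring.jacobson R ^ m := fun m => by
      induction m with
      | zero =>
        intro x
        rw [Submodule.pow_zero, Ideal.one_eq_top]
        exact Submodule.mem_top
      | succ m ih =>
        intro x
        have h1 : x.1.1.r = (s x).sum fun y c => y.1.1.r * c.unop.r := by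
          let toR : K →+ R :=
            { toFun := fun x => x.1.1.r
              map_zero' := rfl
              map_add' := fun _ _ => rfl }
          have := congrArg toR (hs' x)
          rw [Finsupp.sum, map_sum] at this
          exact this
        rw [h1, Submodule.pow_succ]
        exact Submodule.sum_mem _ fun y _ =>
          Ideal.mul_mem_mul (ih y) (IsLocalRing.mem_ringJacobson (hunit x y))
    have hzero : ∀ x : K, x.1.1.r = 0 := fun x => by
      have := hpow n x
      rwa [hn] at this
    -- But if `r ^ (m + 1) = 0`, then `K` contains the matrix with `R`-entry `r ^ m`, so the
    -- nilpotency of `r` again descends to `1 = 0`.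
    have step : ∀ m, r ^ (m + 1) = 0 → r ^ m = 0 := fun m hm => by
      have hmem : (⟨⟨0, 0, r ^ m⟩, rfl⟩ : secondRow H M R) ∈ K := by
        rw [LinearMap.mem_ker]
        apply Subtype.ext
        rw [coe_rowMul]
        ext
        · rfl
        · simp
        · simpa [pow_succ'] using hm
      exact hzero ⟨_, hmem⟩
    have : ∀ m, r ^ m = 0 → False := fun m => by
      induction m with
      | zero => simp
      | succ m ih => exact fun h => ih (step m h)
    exact this n (nil _ hu)

/-- The second row is not in the left part if `R` is local with nilpotent radical, but not a skew
field. -/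
theorem not_leftPart_secondRow [IsLocalRing R] (hnil : IsNilpotent (Ring.jacobson R))
    (hR : ¬ IsSkewField R) {X : ModuleCat.{u} (TriMatrix H M R)ᵐᵒᵖ}
    (w : secondRow H M R ≃ₗ[(TriMatrix H M R)ᵐᵒᵖ] X) : ¬ leftPart (TriMatrix H M R) X := by
  rintro ⟨hX, hpd⟩
  obtain ⟨r, h0, hu⟩ : ∃ r : R, r ≠ 0 ∧ ¬ IsUnit r := by
    by_contra h
    push Not at h
    exact hR ⟨inferInstance, h⟩
  let q : Module.End (TriMatrix H M R)ᵐᵒᵖ (secondRow H M R) := rowMul r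
  have hq : q (secondUnit H M) ≠ 0 := fun h => h0 <| by
    have := congrArg (fun y => y.1.r) h
    simpa [q, coe_rowMul, secondUnit] using this
  let Y : ModuleCat.{u} (TriMatrix H M R)ᵐᵒᵖ := ModuleCat.of _ (LinearMap.range q)
  have : Nontrivial Y := ⟨⟨q (secondUnit H M), secondUnit H M, rfl⟩, 0, fun h =>
    hq (congrArg Subtype.val h)⟩
  have hfin : Module.Finite (TriMatrix H M R)ᵐᵒᵖ (secondRow H M R) :=
    have := hX.1
    Module.Finite.equiv w.symm
  have hY : Ind (TriMatrix H M R) Y :=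
    ⟨Module.Finite.range q, indecomposable_of_surjective q.rangeRestrict q.surjective_rangeRestrict⟩
  have hYX : IsPredecessor (TriMatrix H M R) Y X := by
    refine Relation.TransGen.single ⟨hY, hX,
      ModuleCat.ofHom (w.toLinearMap ∘ₗ (LinearMap.range q).subtype), fun h => hq ?_⟩
    have h1 := LinearMap.congr_fun (congrArg ModuleCat.Hom.hom h)
      ⟨q (secondUnit H M), secondUnit H M, rfl⟩
    exact (LinearEquiv.map_eq_zero_iff w).mp h1
  have : HasProjectiveDimensionLE (ModuleCat.of (TriMatrix H M R)ᵐᵒᵖ (LinearMap.range q)) 1 :=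
    hpd Y hYX
  exact not_projective_ker_rowMul hnil h0 hu (projective_ker_of_projectiveDimensionLE q)

/-! ### Identification of the supporting projective -/

/-- The supporting projective of the left part is the first row. -/
theorem nonempty_supportingProjective_equiv_firstRow
    [IsArtinianRing (TriMatrix H M R)ᵐᵒᵖ] (hA : IsBasicRing (TriMatrix H M R))
    (hH : IsRightHereditary H) [IsLocalRing R] (hnil : IsNilpotent (Ring.jacobson R))
    (hR : ¬ IsSkewField R) :
    Nonempty (SupportingProjective (leftPart (TriMatrix H M R)) ≃ₗ[(TriMatrix H M R)ᵐᵒᵖ]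
      firstRow H M R) := by
  obtain ⟨n, P, hP, h_ind, h_ne⟩ := hA
  obtain ⟨s, hs, h_same, h_diff⟩ := hP.exists_projections
  have : IsNoetherian (TriMatrix H M R)ᵐᵒᵖ (TriMatrix H M R) :=
    isNoetherian_of_linearEquiv (opEquiv (TriMatrix H M R))
  let π := (secondRow H M R).projectionOnto (firstRow H M R) isCompl_rows
  -- The identity of the second row is the sum of its factorizations through the summands `P i`;
  -- locality singles out the summand `P i₀` isomorphic to the second row.
  obtain ⟨i₀, -, h₀⟩ := IsLocalRing.exists_isUnit_of_sum Finset.univ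
    (fun i => ((π ∘ₗ (P i).subtype) ∘ₗ (s i ∘ₗ (secondRow H M R).subtype) :
      Module.End (TriMatrix H M R)ᵐᵒᵖ (secondRow H M R))) (by
    convert isUnit_one
    ext1 x
    simp only [LinearMap.sum_apply, LinearMap.comp_apply, Submodule.subtype_apply]
    rw [← map_sum, hs]
    exact Submodule.projectionOnto_apply_left isCompl_rows x)
  have hb := bijective_of_isUnit_comp (h_ind i₀) (s i₀ ∘ₗ (secondRow H M R).subtype)
    (π ∘ₗ (P i₀).subtype) h₀
  let w₀ : secondRow H M R ≃ₗ[(TriMatrix H M R)ᵐᵒᵖ] P i₀ := LinearEquiv.ofBijective _ hb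
  obtain ⟨d⟩ := nonempty_equiv_directSum_of_bijective P s hs h_same h_diff i₀ isCompl_rows hb
  have hj : ∀ i : {i // i ≠ i₀}, ∃ j : P i →ₗ[(TriMatrix H M R)ᵐᵒᵖ] TriMatrix H M R,
      Function.Injective j ∧ LinearMap.range j ≤ firstRow H M R := fun i => by
    refine ⟨(firstRow H M R).subtype ∘ₗ d.symm.toLinearMap ∘ₗ
      DirectSum.lof (TriMatrix H M R)ᵐᵒᵖ {i // i ≠ i₀} (fun i => P i) i, ?_, ?_⟩
    · exact (firstRow H M R).subtype_injective.comp (d.symm.injective.comp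
        (DirectSum.of_injective i))
    · rintro _ ⟨x, rfl⟩
      exact (d.symm _).2
  obtain ⟨f⟩ := nonempty_supportingProjective_equiv (leftPart (TriMatrix H M R))
    (fun i : {i // i ≠ i₀} => ModuleCat.of (TriMatrix H M R)ᵐᵒᵖ (P i))
    (fun i => leftPart_of_injective hH
      ⟨inferInstanceAs (Module.Finite (TriMatrix H M R)ᵐᵒᵖ (P i)), h_ind i⟩ (hj i))
    (fun i => projective_of_injective hH (hj i))
    (fun i j hij => ⟨fun f => (h_ne i j fun h => hij (Subtype.ext h)).false f.toLinearEquiv⟩)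
    (fun X hX hX' => by
      have := hX.1.1
      obtain ⟨i, ⟨w⟩⟩ := exists_equiv_of_projective (opEquiv (TriMatrix H M R)) P s hs h_ind hX.1.2
      have hi : i ≠ i₀ := by
        rintro rfl
        exact not_leftPart_secondRow hnil hR (w₀ ≪≫ₗ w.symm) hX
      exact ⟨⟨i, hi⟩, ⟨w.toModuleIso⟩⟩)
  exact ⟨f ≪≫ₗ d.symm⟩

/-! ### Endomorphisms of the first row and the left support -/

theorem e_mul_of_mem_firstRow {x : TriMatrix H M R} (hx : x ∈ firstRow H M R) :
    e H M R * x = x := by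
  rw [← inl_of_mem_firstRow hx]
  ext <;> simp [e, inl]

/-- Left multiplication by `[[h, 0], [0, 0]]` on the first row. -/
def firstRowMul (h : H) : Module.End (TriMatrix H M R)ᵐᵒᵖ (firstRow H M R) where
  toFun x := ⟨inl M R h * x.1, by rw [inl_mul]; exact inl_mem_firstRow M R _⟩
  map_add' x y := Subtype.ext (mul_add _ _ _)
  map_smul' a x := Subtype.ext (mul_assoc _ _ _).symm

/-- Endomorphisms of the first row are left multiplications. -/
theorem end_firstRow_apply (f : Module.End (TriMatrix H M R)ᵐᵒᵖ (firstRow H M R))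
    (x : firstRow H M R) :
    (f x : TriMatrix H M R) =
      inl M R (f ⟨e H M R, inl_mem_firstRow M R 1⟩).1.h * (x : TriMatrix H M R) := by
  have hx : x = MulOpposite.op x.1 • (⟨e H M R, inl_mem_firstRow M R 1⟩ : firstRow H M R) :=
    Subtype.ext (e_mul_of_mem_firstRow x.2).symm
  conv_lhs => rw [hx, map_smul]
  rw [inl_of_mem_firstRow (f _).2]
  rfl

/-- The endomorphism ring of the first row is `H`. -/
def endFirstRowEquiv (H M R : Type u) [Ring H] [AddCommGroup M] [Ring R] [Module R M]
    [Module Hᵐᵒᵖ M] [SMulCommClass R Hᵐᵒᵖ M] :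
    Module.End (TriMatrix H M R)ᵐᵒᵖ (firstRow H M R) ≃+* H where
  toFun f := (f ⟨e H M R, inl_mem_firstRow M R 1⟩).1.h
  invFun := firstRowMul
  left_inv f := LinearMap.ext fun x => Subtype.ext (end_firstRow_apply f x).symm
  right_inv h := by simp [firstRowMul, inl, e]
  map_mul' f g := by
    rw [Module.End.mul_apply, end_firstRow_apply]
    rfl
  map_add' f g := rfl

end TriMatrix

theorem mainTheorem8 {k : Type v} [CommRing k] [IsArtinianRing k]
    {H M R : Type u}
    [Ring H] [Algebra k H] [Module.Finite k H]
    [Ring R] [Algebra k R] [Module.Finite k R]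
    [AddCommGroup M] [Module k M] [Module.Finite k M]
    [Module R M] [Module Hᵐᵒᵖ M] [SMulCommClass R Hᵐᵒᵖ M]
    [IsScalarTower k R M] [IsScalarTower k Hᵐᵒᵖ M]
    (hA : IsBasicRing (TriMatrix H M R))
    (hH : IsRightHereditary H)
    [IsLocalRing R] (hR : ¬ IsSkewField R) :
    ∃ (φ : SupportingProjective (leftPart (TriMatrix H M R)) ≃ₗ[(TriMatrix H M R)ᵐᵒᵖ]
          TriMatrix.firstRow H M R)
      (ψ : LeftSupport (TriMatrix H M R) ≃ₐ[k] H),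
      ∀ (f : LeftSupport (TriMatrix H M R))
        (p : SupportingProjective (leftPart (TriMatrix H M R))),
        (φ (f p) : TriMatrix H M R) = TriMatrix.inl M R (ψ f) * (φ p : TriMatrix H M R) := by
  have : Module.Finite k (TriMatrix H M R) := TriMatrix.moduleFinite
  have : Module.Finite k (TriMatrix H M R)ᵐᵒᵖ :=
    Module.Finite.equiv (MulOpposite.opLinearEquiv k)
  have : IsArtinianRing (TriMatrix H M R)ᵐᵒᵖ := IsArtinianRing.of_finite k _
  have : IsArtinianRing R := IsArtinianRing.of_finite k R
  obtain ⟨φ⟩ := TriMatrix.nonempty_supportingProjective_equiv_firstRow hA hH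
    IsSemiprimaryRing.isNilpotent hR
  -- Conjugation by `φ`, then the `H`-entry of the value at `e`.
  let ψ : LeftSupport (TriMatrix H M R) ≃+* H :=
    φ.conjRingEquiv.trans (TriMatrix.endFirstRowEquiv H M R)
  have hψ : ∀ c : k, ψ (algebraMap k _ c) = algebraMap k H c := fun c => by
    have h1 : ∀ x, algebraMap k (LeftSupport (TriMatrix H M R)) c x =
        algebraMap k (TriMatrix H M R)ᵐᵒᵖ c • x := fun _ => rfl
    change (φ (algebraMap k (LeftSupport (TriMatrix H M R)) c (φ.symm _))).1.h = _
    rw [h1, map_smul, φ.apply_symm_apply]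
    change (1 : H) * algebraMap k H c = _
    rw [one_mul]
  refine ⟨φ, AlgEquiv.ofRingEquiv hψ, fun f p => ?_⟩
  have := TriMatrix.end_firstRow_apply (φ.conjRingEquiv f) (φ p)
  rw [LinearEquiv.conjRingEquiv_apply_apply, φ.symm_apply_apply] at this
  exact this
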